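/- Let $\mathbb K$ be a field, $S=\mathbb K[x_1,\dots,x_n]$, $X=\{x_1,\dots,x_n\}$, and let $F=Se_1\oplus\dots\oplus Se_m$ be a graded free $S$-module with $\deg(e_j)\ge 0$ integers and $l=\max\{\deg(e_1),\dots,\deg(e_m)\}$. Fix a monomial order $\prec$ on $F$, that is, a total order on the monomials $x^ae_j$ that is preserved by multiplication by monomials of $S$ and satisfies $\mu\prec x^c\mu$ for all monomials $\mu$ of $F$ and $x^c\ne 1$ of $S$. A Gröbner basis of a submodule $M\subseteq F$ is a finite subset of $M$ such that the initial monomials of its nonzero elements generate the submodule $\mathrm{in}_\prec(M)$ generated by the initial monomials of all nonzero elements of $M$; it is reduced if all its elements have leading coefficient $1$ and no monomial of an element is divisible by the initial monomial of another element. For a Gröbner basis $G$ of $M$ let $N_M=\{\mathrm{nf}_G(f):f\in F\}$ be the set of normal forms (remainders on division by $G$). A cone is a $\mathbb K$-subspace $C=C(h,u)=h\,\mathbb K[u]\subseteq F$ with $0\ne h\in F$ homogeneous and $u\subseteq X$; put $\deg(C)=\deg(h)$ and $\dim(C)=|u|$. A cone decomposition of $T\subseteq F$ is a finite set $P$ of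 cones whose direct sum, as $\mathbb K$-vector spaces, is $T$; put $\deg(P)=\max\{\deg(C):C\in P\}$, with $\deg(\emptyset)=-\infty$. It is $q$-standard if no $C\in P$ with $\dim(C)>0$ has $\deg(C)<q$, and for every $C\in P$ with $\dim(C)>0$ and every integer $d$ with $q\le d\le\deg(C)$ there is $C'\in P$ with $\deg(C')=d$ and $\dim(C')\ge\dim(C)$. Theorem. Let $G$ be a Gröbner basis, consisting of homogeneous elements, of a graded submodule $M\subseteq F$ with respect to $\prec$. Then $N_M$ admits an $l$-standard cone decomposition $Q$ such that $$G'=\{g\in G:\deg(g)\le\max\{1+\deg(Q),l\}\}$$ is also a Gröbner basis of $M$ with respect to $\prec$. In particular, every element of the reduced Gröbner basis of $M$ with respect to $\prec$ has degree at most $\max\{1+\deg(Q),l\}$. -/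

import Mathlib

noncomputable section

namespace FreeModGB

/-- The polynomial ring `S = 𝕜[x_1, …, x_n]`. -/
abbrev Poly (𝕜 : Type*) [Field 𝕜] (n : ℕ) := MvPolynomial (Fin n) 𝕜

/-- The free module `F = S e_1 ⊕ ⋯ ⊕ S e_m`. Its grading is given by a weight vector
`w : Fin m → ℕ`, where `w j = deg e_j`. -/
abbrev FreeMod (𝕜 : Type*) [Field 𝕜] (n m : ℕ) := Fin m → Poly 𝕜 n

/-- Monomials `x^a e_j` of `F`, encoded by the pair `(a, j)`. -/
abbrev Mon (n m : ℕ) := (Fin n →₀ ℕ) × Fin m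

variable {𝕜 : Type*} [Field 𝕜] {n m : ℕ}

/-- The element `x^a e_j` of `F`. -/
def Mon.toMod (𝕜 : Type*) [Field 𝕜] {n m : ℕ} (μ : Mon n m) : FreeMod 𝕜 n m :=
  Pi.single μ.2 (MvPolynomial.monomial μ.1 1)

/-- The degree of the monomial `x^a e_j`. -/
def Mon.deg (w : Fin m → ℕ) (μ : Mon n m) : ℕ := μ.1.degree + w μ.2

/-- `μ` divides `ν`, i.e. `ν = x^c μ` for some monomial `x^c` of `S`. -/
def Mon.Dvd (μ ν : Mon n m) : Prop := μ.2 = ν.2 ∧ μ.1 ≤ ν.1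

/-- The coefficient of the monomial `x^a e_j` in `f`. -/
def coeffAt (μ : Mon n m) (f : FreeMod 𝕜 n m) : 𝕜 := MvPolynomial.coeff μ.1 (f μ.2)

/-- The set of monomials of `f`. -/
def monomials (f : FreeMod 𝕜 n m) : Set (Mon n m) := {μ | coeffAt μ f ≠ 0}

/-- The degree of an element of `F`: the largest degree of its monomials (`⊥` for `0`). -/
def deg (w : Fin m → ℕ) (f : FreeMod 𝕜 n m) : WithBot ℕ :=
  Finset.univ.sup fun j => (f j).support.sup fun a => ((Mon.deg w (a, j) : ℕ) : WithBot ℕ)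

/-- `f` is homogeneous of degree `d` (the zero element is so for every `d`). -/
def IsHomogeneousOfDeg (w : Fin m → ℕ) (d : ℕ) (f : FreeMod 𝕜 n m) : Prop :=
  ∀ μ ∈ monomials f, Mon.deg w μ = d

/-- `f` is homogeneous. -/
def IsHomogeneous (w : Fin m → ℕ) (f : FreeMod 𝕜 n m) : Prop :=
  ∃ d, IsHomogeneousOfDeg w d f

/-- The homogeneous component of degree `d` of `f`. -/
def homComponent (w : Fin m → ℕ) (d : ℕ) (f : FreeMod 𝕜 n m) : FreeMod 𝕜 n m := fun j =>
  if w j ≤ d then MvPolynomial.homogeneousComponent (d - w j) (f j) else 0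

/-- A graded submodule: it contains all homogeneous components of its elements. -/
def IsGraded (w : Fin m → ℕ) (M : Submodule (Poly 𝕜 n) (FreeMod 𝕜 n m)) : Prop :=
  ∀ f ∈ M, ∀ d, homComponent w d f ∈ M

/-- A monomial order on `F`: a strict total order on the monomials of `F` which is preserved by
multiplication by monomials of `S` and satisfies `μ ≺ x^c μ` for every monomial `x^c ≠ 1` of `S`. -/
structure MonOrder (n m : ℕ) where
  lt : Mon n m → Mon n m → Prop
  irrefl : ∀ μ, ¬ lt μ μ
  trans : ∀ μ ν ρ, lt μ ν → lt ν ρ → lt μ ρ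
  total : ∀ μ ν, lt μ ν ∨ μ = ν ∨ lt ν μ
  mul_lt_mul : ∀ (c a b : Fin n →₀ ℕ) (i j : Fin m), lt (a, i) (b, j) → lt (c + a, i) (c + b, j)
  lt_mul : ∀ (c a : Fin n →₀ ℕ) (i : Fin m), c ≠ 0 → lt (a, i) (c + a, i)

/-- `μ = in_≺(f)`: `μ` is the greatest monomial of `f`. -/
def IsInitial (o : MonOrder n m) (f : FreeMod 𝕜 n m) (μ : Mon n m) : Prop :=
  μ ∈ monomials f ∧ ∀ ν ∈ monomials f, ν = μ ∨ o.lt ν μ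

/-- The submodule generated by the initial monomials of the nonzero elements of `A`. -/
def initialSpan (o : MonOrder n m) (A : Set (FreeMod 𝕜 n m)) :
    Submodule (Poly 𝕜 n) (FreeMod 𝕜 n m) :=
  Submodule.span (Poly 𝕜 n) {e | ∃ f ∈ A, ∃ μ, IsInitial o f μ ∧ e = Mon.toMod 𝕜 μ}

/-- `G` is a (finite) Gröbner basis of `M`. -/
def IsGroebnerBasis (o : MonOrder n m) (M : Submodule (Poly 𝕜 n) (FreeMod 𝕜 n m))
    (G : Set (FreeMod 𝕜 n m)) : Prop :=
  G.Finite ∧ G ⊆ (M : Set (FreeMod 𝕜 n m)) ∧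
    initialSpan o G = initialSpan o (M : Set (FreeMod 𝕜 n m))

/-- `G` is a reduced Gröbner basis of `M`: a Gröbner basis whose elements have leading coefficient
`1`, such that no monomial of an element `g` is divisible by the initial monomial of another
element of `G`. -/
def IsReducedGroebnerBasis (o : MonOrder n m) (M : Submodule (Poly 𝕜 n) (FreeMod 𝕜 n m))
    (G : Set (FreeMod 𝕜 n m)) : Prop :=
  IsGroebnerBasis o M G ∧
    (∀ g ∈ G, ∃ μ, IsInitial o g μ ∧ coeffAt μ g = 1) ∧
    ∀ g ∈ G, ∀ g' ∈ G, g' ≠ g → ∀ μ, IsInitial o g' μ → ∀ ν ∈ monomials g, ¬ Mon.Dvd μ ν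

/-- `r` is a remainder of `f` with respect to `G`: `f = ∑ a_g g + r` with `in(a_g g) ≼ in(f)`
whenever `a_g g ≠ 0`, and no monomial of `r` is divisible by the initial monomial of an element
of `G`. -/
def IsRemainder (o : MonOrder n m) (G : Set (FreeMod 𝕜 n m)) (f r : FreeMod 𝕜 n m) : Prop :=
  ∃ a : FreeMod 𝕜 n m →₀ Poly 𝕜 n,
    (↑a.support ⊆ G) ∧
    f = (a.sum fun g c => c • g) + r ∧
    (∀ g ∈ G, ∀ μ, IsInitial o (a g • g) μ → ∃ ν, IsInitial o f ν ∧ (μ = ν ∨ o.lt μ ν)) ∧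
    ∀ g ∈ G, ∀ μ, IsInitial o g μ → ∀ ν ∈ monomials r, ¬ Mon.Dvd μ ν

/-- The set `N_M = {nf_G(f) : f ∈ F}` of normal forms, for a Gröbner basis `G` of `M`. -/
def normalForms (o : MonOrder n m) (G : Set (FreeMod 𝕜 n m)) : Set (FreeMod 𝕜 n m) :=
  {r | ∃ f, IsRemainder o G f r}

/-- A cone `C(h, u) = h 𝕜[u]`, given by its pivot `h`, a nonzero homogeneous element of `F`, and a
set `u` of variables. As `h ≠ 0`, the field `deg` is determined by `h`. -/
structure Cone (𝕜 : Type*) [Field 𝕜] (n : ℕ) {m : ℕ} (w : Fin m → ℕ) where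
  pivot : FreeMod 𝕜 n m
  vars : Finset (Fin n)
  deg : ℕ
  pivot_ne_zero : pivot ≠ 0
  pivot_homogeneous : IsHomogeneousOfDeg w deg pivot

variable {w : Fin m → ℕ}

/-- The dimension `|u|` of the cone `C(h, u)`. -/
def Cone.dim (C : Cone 𝕜 n w) : ℕ := C.vars.card

/-- The underlying `𝕜`-vector space `h 𝕜[u]` of the cone `C(h, u)`. -/
def Cone.space (C : Cone 𝕜 n w) : Submodule 𝕜 (FreeMod 𝕜 n m) :=
  (Subalgebra.toSubmodule (MvPolynomial.supported 𝕜 (C.vars : Set (Fin n)))).map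
    ((LinearMap.toSpanSingleton (Poly 𝕜 n) (FreeMod 𝕜 n m) C.pivot).restrictScalars 𝕜)

/-- `P` is a cone decomposition of `T`: `T` is the direct sum of the cones in `P`. -/
def IsConeDecomposition (P : Finset (Cone 𝕜 n w)) (T : Set (FreeMod 𝕜 n m)) : Prop :=
  iSupIndep (fun C : P => C.1.space) ∧
    ((⨆ C : P, C.1.space : Submodule 𝕜 (FreeMod 𝕜 n m)) : Set (FreeMod 𝕜 n m)) = T

/-- The degree of a finite set of cones: the maximum of their degrees (`⊥` for the empty set). -/
def coneDeg (P : Finset (Cone 𝕜 n w)) : WithBot ℕ := P.sup fun C => (C.deg : WithBot ℕ)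

/-- The `q`-standard condition on a finite set of cones. -/
def IsStandard (q : ℕ) (P : Finset (Cone 𝕜 n w)) : Prop :=
  (∀ C ∈ P, 0 < C.dim → ¬ C.deg < q) ∧
    ∀ C ∈ P, 0 < C.dim → ∀ d, q ≤ d → d ≤ C.deg → ∃ C' ∈ P, C'.deg = d ∧ C.dim ≤ C'.dim

end FreeModGB

end

/-!
The normal forms with respect to `G` are the elements of `F` none of whose monomials lies in the
set `initialMonomials o G` of multiples of the initial monomials of `G`. So `N_M` is spanned over
`𝕜` by monomials, and cones with monomial pivots suffice: such a cone is spanned by the monomials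
in a cell, and a partition of the set `N` of normal monomials into cells is a cone decomposition.

A partition is found one component `S e_j` at a time, splitting recursively
`x^a 𝕜[u] = x^a 𝕜[u ∖ {x}] ⊔ x^{a + x} 𝕜[u]`. A cell whose pivot is not in `N` is dropped. A cell
of degree `< l` is split along any of its variables, so that only single monomials remain below degree `l`. A cell of degree `≥ l` is kept
if it lies in `N`, and is otherwise split along a variable outside a largest set `s` of variables
with `x^a 𝕜[s] ⊆ N`. Then `x^a 𝕜[s]` survives up to replacing `s` by another set of the same size,
and it supplies a cone of degree `deg x^a` whose dimension is maximal among all cones produced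
(`IsStandardPartition.union`); this gives the standard property. It also bounds the generators
of the initial module. A minimal generator in the cell stays minimal in the part that contains it,
until it is the pivot of a cell; the cell it was split from then has a pivot of degree one less
that is normal, hence a cone of that degree, unless the degrees are still at most `l`
(`exists_standard_coneDecomposition`).

An element of a Gröbner basis that is homogeneous has the degree of its initial monomial, and the
elements whose initial monomials are minimal generators already form a Gröbner basis. A reduced
Gröbner basis consists of such elements only (`IsReducedGroebnerBasis.isMinimalInitial`) and is
homogeneous since `M` is graded (`IsReducedGroebnerBasis.isHomogeneous`).
-/

/-! ### Cells of monomials and their standard partitions -/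

namespace FreeModGB

section Cells

variable {σ : Type*}

/-- The set of exponents of the monomials in the cone `x^a 𝕜[u]`. -/
def cell (a : σ →₀ ℕ) (u : Finset σ) : Set (σ →₀ ℕ) :=
  {b | a ≤ b ∧ ∀ i, i ∉ u → b i = a i}

theorem self_mem_cell (a : σ →₀ ℕ) (u : Finset σ) : a ∈ cell a u :=
  ⟨le_rfl, fun _ _ => rfl⟩

theorem mem_cell_empty {a b : σ →₀ ℕ} : b ∈ cell a ∅ ↔ b = a :=
  ⟨fun h => Finsupp.ext fun i => h.2 i (Finset.notMem_empty i), fun h => h ▸ self_mem_cell b ∅⟩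

theorem cell_mono (a : σ →₀ ℕ) {u v : Finset σ} (h : u ⊆ v) : cell a u ⊆ cell a v :=
  fun _ hb => ⟨hb.1, fun i hi => hb.2 i fun hu => hi (h hu)⟩

/-- The partition `x^a 𝕜[u] = x^a 𝕜[u ∖ {x}] ⊔ x^{a + x} 𝕜[u]`. -/
theorem mem_cell_iff_erase_or_succ [DecidableEq σ] {a b : σ →₀ ℕ} {u : Finset σ} {x : σ}
    (hx : x ∈ u) :
    b ∈ cell a u ↔ b ∈ cell a (u.erase x) ∨ b ∈ cell (a + Finsupp.single x 1) u := by
  constructor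
  · rintro ⟨h1, h2⟩
    by_cases h : b x = a x
    · refine Or.inl ⟨h1, fun i hi => ?_⟩
      by_cases hix : i = x
      · rw [hix, h]
      · exact h2 i fun hu => hi (Finset.mem_erase.2 ⟨hix, hu⟩)
    · refine Or.inr ⟨fun i => ?_, fun i hi => ?_⟩
      · have := h1 i
        rw [Finsupp.add_apply, Finsupp.single_apply]
        split_ifs with hxi
        · subst hxi; omega
        · simpa using this
      · have : x ≠ i := fun e => hi (e ▸ hx)
        simp [h2 i hi, this]
  · rintro (h | ⟨h1, h2⟩)
    · exact cell_mono a (Finset.erase_subset x u) h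
    · refine ⟨le_self_add.trans h1, fun i hi => ?_⟩
      have : x ≠ i := fun e => hi (e ▸ hx)
      simp [h2 i hi, this]

theorem notMem_cell_succ_of_mem_cell_erase [DecidableEq σ] {a b : σ →₀ ℕ} {u : Finset σ} {x : σ}
    (h : b ∈ cell a (u.erase x)) : b ∉ cell (a + Finsupp.single x 1) u := by
  intro h'
  have h1 := h.2 x (Finset.notMem_erase x u)
  have h2 := h'.1 x
  simp [h1] at h2

/-- If a cell lies in another one, it involves fewer variables. -/
theorem vars_subset_of_cell_subset {a b : σ →₀ ℕ} {u v : Finset σ} (h : cell b v ⊆ cell a u) :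
    v ⊆ u := by
  classical
  intro i hi
  by_contra hu
  have h1 : b + Finsupp.single i 1 ∈ cell b v := by
    refine ⟨le_self_add, fun k hk => ?_⟩
    have : i ≠ k := fun e => hk (e ▸ hi)
    simp [this]
  have h2 := (h h1).2 i hu
  have h3 := (h (self_mem_cell b v)).2 i hu
  simp [h3] at h2

/-- A lower set that contains the translate `cell b v` of `cell a v` contains `cell a v`. -/
theorem cell_subset_of_le {N : Set (σ →₀ ℕ)} (hN : IsLowerSet N) {a b : σ →₀ ℕ} {v : Finset σ}
    (hab : a ≤ b) (h : cell b v ⊆ N) : cell a v ⊆ N := by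
  intro c hc
  have : c + (b - a) ∈ cell b v := by
    refine ⟨fun i => ?_, fun i hi => ?_⟩
    · have h1 := hc.1 i
      have h2 := hab i
      simp only [Finsupp.add_apply, Finsupp.tsub_apply]
      omega
    · have h1 := hc.2 i hi
      have h2 := hab i
      simp only [Finsupp.add_apply, Finsupp.tsub_apply]
      omega
  exact hN le_self_add (h this)

/-- `P`, a finite set of pairs `(b, v)` standing for the cones `x^b 𝕜[v]`, is a standard partition
of the part of `N` that lies in `cell a u`. Above the degree `max q a.degree` it has the
`q`-standard property, and in degree `a.degree ≥ q` it has a cone of the largest dimension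
possible. The field `bound` says that `P` detects the minimal elements of the complement of `N`
in `cell a u`: their degrees exceed `P`'s largest degree by at most one. -/
structure IsStandardPartition (N : Set (σ →₀ ℕ)) (q : ℕ) (a : σ →₀ ℕ) (u : Finset σ)
    (P : Finset ((σ →₀ ℕ) × Finset σ)) : Prop where
  disjoint : ∀ C ∈ P, ∀ C' ∈ P, C ≠ C' → Disjoint (cell C.1 C.2) (cell C'.1 C'.2)
  mem_iff : ∀ b, (∃ C ∈ P, b ∈ cell C.1 C.2) ↔ b ∈ N ∧ b ∈ cell a u
  top : q ≤ a.degree → ∀ s ⊆ u, cell a s ⊆ N →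
    ∃ C ∈ P, C.1.degree = a.degree ∧ s.card ≤ C.2.card
  le_degree : ∀ C ∈ P, 0 < C.2.card → q ≤ C.1.degree
  standard : ∀ C ∈ P, 0 < C.2.card → ∀ d, q ≤ d → a.degree ≤ d → d ≤ C.1.degree →
    ∃ C' ∈ P, C'.1.degree = d ∧ C.2.card ≤ C'.2.card
  bound : ∀ g ∈ cell a u, g ∉ N → (∀ g' ∈ cell a u, g' ∉ N → g' ≤ g → g' = g) →
    g.degree ≤ q ∨ g.degree ≤ a.degree ∨ ∃ C ∈ P, g.degree ≤ 1 + C.1.degree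

theorem IsStandardPartition.cell_subset {N : Set (σ →₀ ℕ)} {q : ℕ} {a : σ →₀ ℕ} {u : Finset σ}
    {P : Finset ((σ →₀ ℕ) × Finset σ)} (h : IsStandardPartition N q a u P)
    {C : (σ →₀ ℕ) × Finset σ} (hC : C ∈ P) : cell C.1 C.2 ⊆ N ∩ cell a u :=
  fun b hb => (h.mem_iff b).1 ⟨C, hC, hb⟩

theorem isStandardPartition_empty {N : Set (σ →₀ ℕ)} (hN : IsLowerSet N) {q : ℕ} {a : σ →₀ ℕ}
    {u : Finset σ} (ha : a ∉ N) : IsStandardPartition N q a u ∅ where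
  disjoint := by simp
  mem_iff b := by
    simp only [Finset.notMem_empty, false_and, exists_false, false_iff, not_and]
    exact fun hb hc => ha (hN hc.1 hb)
  top _ s _ hs := (ha (hs (self_mem_cell a s))).elim
  le_degree := by simp
  standard := by simp
  bound g hg _ hmin := by
    rw [← hmin a (self_mem_cell a u) ha hg.1]
    exact Or.inr (Or.inl le_rfl)

theorem isStandardPartition_singleton {N : Set (σ →₀ ℕ)} {q : ℕ} {a : σ →₀ ℕ}
    {u : Finset σ} (ha : cell a u ⊆ N) (hu : 0 < u.card → q ≤ a.degree) :
    IsStandardPartition N q a u {(a, u)} where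
  disjoint C hC C' hC' h := by simp_all
  mem_iff b := by simpa using fun h => ha h
  top _ s hs _ := ⟨(a, u), by simp, rfl, Finset.card_le_card hs⟩
  le_degree := by simpa using hu
  standard C hC _ d _ h1 h2 := by
    obtain rfl := Finset.mem_singleton.1 hC
    exact ⟨(a, u), by simp, le_antisymm h1 h2, le_rfl⟩
  bound g hg hgN := (hgN (ha hg)).elim

/-- Gluing along `x^a 𝕜[u] = x^a 𝕜[u ∖ {x}] ⊔ x^{a + x} 𝕜[u]`. Once `q ≤ a.degree`, the variable
`x` has to avoid a set `s` of maximal size with `cell a s ⊆ N`: then the first part has a cone of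
degree `a.degree` whose dimension is maximal, which the second part needs for standardness. -/
theorem IsStandardPartition.union [DecidableEq σ] {N : Set (σ →₀ ℕ)} (hN : IsLowerSet N) {q : ℕ}
    {a : σ →₀ ℕ} {u : Finset σ} {x : σ} {P₁ P₂ : Finset ((σ →₀ ℕ) × Finset σ)}
    (hx : x ∈ u) (ha : a ∈ N)
    (hs : q ≤ a.degree → ∃ s ⊆ u.erase x, cell a s ⊆ N ∧
      ∀ s' ⊆ u, cell a s' ⊆ N → s'.card ≤ s.card)
    (h₁ : IsStandardPartition N q a (u.erase x) P₁)
    (h₂ : IsStandardPartition N q (a + Finsupp.single x 1) u P₂) :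
    IsStandardPartition N q a u (P₁ ∪ P₂) := by
  have hdeg : (a + Finsupp.single x 1).degree = a.degree + 1 := by
    rw [map_add, Finsupp.degree_single]
  have hdisj : ∀ C ∈ P₁, ∀ C' ∈ P₂, Disjoint (cell C.1 C.2) (cell C'.1 C'.2) := by
    intro C hC C' hC'
    rw [Set.disjoint_left]
    exact fun b hb hb' => notMem_cell_succ_of_mem_cell_erase (h₁.cell_subset hC hb).2
      (h₂.cell_subset hC' hb').2
  refine ⟨?_, ?_, ?_, ?_, ?_, ?_⟩
  · intro C hC C' hC' hne
    rcases Finset.mem_union.1 hC with hC | hC <;> rcases Finset.mem_union.1 hC' with hC' | hC'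
    · exact h₁.disjoint C hC C' hC' hne
    · exact hdisj C hC C' hC'
    · exact (hdisj C' hC' C hC).symm
    · exact h₂.disjoint C hC C' hC' hne
  · intro b
    rw [mem_cell_iff_erase_or_succ hx, and_or_left, ← h₁.mem_iff, ← h₂.mem_iff]
    simp only [Finset.mem_union, or_and_right, exists_or]
  · intro hq s' hs' hsN
    obtain ⟨s, hsu, hsN', hmax⟩ := hs hq
    obtain ⟨C, hC, h1, h2⟩ := h₁.top hq s hsu hsN'
    exact ⟨C, Finset.mem_union_left _ hC, h1, (hmax s' hs' hsN).trans h2⟩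
  · intro C hC
    rcases Finset.mem_union.1 hC with hC | hC
    · exact h₁.le_degree C hC
    · exact h₂.le_degree C hC
  · intro C hC hpos d hqd had hdC
    rcases Finset.mem_union.1 hC with hC | hC
    · obtain ⟨C', hC', h⟩ := h₁.standard C hC hpos d hqd had hdC
      exact ⟨C', Finset.mem_union_left _ hC', h⟩
    · rcases had.eq_or_lt with rfl | had
      · obtain ⟨s, hsu, hsN, hmax⟩ := hs hqd
        obtain ⟨C', hC', h1, h2⟩ := h₁.top hqd s hsu hsN
        have hsub := h₂.cell_subset hC
        have hle : a ≤ C.1 := le_self_add.trans (hsub (self_mem_cell _ _)).2.1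
        refine ⟨C', Finset.mem_union_left _ hC', h1, (hmax C.2 ?_ ?_).trans h2⟩
        · exact vars_subset_of_cell_subset fun b hb => (hsub hb).2
        · exact cell_subset_of_le hN hle fun b hb => (hsub hb).1
      · obtain ⟨C', hC', h⟩ := h₂.standard C hC hpos d hqd (by omega) hdC
        exact ⟨C', Finset.mem_union_right _ hC', h⟩
  · intro g hg hgN hmin
    rcases (mem_cell_iff_erase_or_succ hx).1 hg with hg | hg
    · rcases h₁.bound g hg hgN fun g' hg' =>
        hmin g' ((mem_cell_iff_erase_or_succ hx).2 (Or.inl hg')) with h | h | ⟨C, hC, h⟩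
      · exact Or.inl h
      · exact Or.inr (Or.inl h)
      · exact Or.inr (Or.inr ⟨C, Finset.mem_union_left _ hC, h⟩)
    · rcases h₂.bound g hg hgN fun g' hg' =>
        hmin g' ((mem_cell_iff_erase_or_succ hx).2 (Or.inr hg')) with h | h | ⟨C, hC, h⟩
      · exact Or.inl h
      · -- Here `g = a + x`, and `P₁` has a cone of degree `a.degree` as soon as `q ≤ a.degree`.
        rcases lt_or_ge a.degree q with hq | hq
        · exact Or.inl (by omega)
        · obtain ⟨C, hC, h1, -⟩ := h₁.top hq ∅ (Finset.empty_subset _)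
            (fun b hb => mem_cell_empty.1 hb ▸ ha)
          exact Or.inr (Or.inr ⟨C, Finset.mem_union_left _ hC, by omega⟩)
      · exact Or.inr (Or.inr ⟨C, Finset.mem_union_right _ hC, h⟩)

/-- Existence of standard partitions. The hypothesis `hD` holds if all minimal elements of the
complement of `N` have exponents at most `D`. Only variables `x` with `a x < D` are ever split
off, so the recursion ends. -/
theorem exists_isStandardPartition [Fintype σ] {N : Set (σ →₀ ℕ)} (hN : IsLowerSet N) {q D : ℕ}
    (hqD : q ≤ D) (hD : ∀ a ∈ N, ∀ x, D ≤ a x → ∀ k, a + Finsupp.single x k ∈ N)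
    (a : σ →₀ ℕ) (u : Finset σ) : ∃ P, IsStandardPartition N q a u P := by
  classical
  induction hk : (∑ i, (D - a i)) + u.card using Nat.strong_induction_on generalizing a u with
  | _ k ih =>
  by_cases ha : a ∈ N
  swap
  · exact ⟨∅, isStandardPartition_empty hN ha⟩
  have step : ∀ x ∈ u, a x < D → (q ≤ a.degree → ∃ s ⊆ u.erase x, cell a s ⊆ N ∧
      ∀ s' ⊆ u, cell a s' ⊆ N → s'.card ≤ s.card) → ∃ P, IsStandardPartition N q a u P := by
    intro x hx hxD hs
    obtain ⟨P₁, h₁⟩ := ih _ (by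
      rw [← hk]
      exact Nat.add_lt_add_left (Finset.card_erase_lt_of_mem hx) _) a (u.erase x) rfl
    obtain ⟨P₂, h₂⟩ := ih _ (by
      rw [← hk]
      refine Nat.add_lt_add_right (Finset.sum_lt_sum (fun i _ => ?_) ⟨x, Finset.mem_univ x, ?_⟩) _
      · simp only [Finsupp.add_apply]
        omega
      · simp only [Finsupp.add_apply, Finsupp.single_eq_same]
        omega) (a + Finsupp.single x 1) u rfl
    exact ⟨P₁ ∪ P₂, h₁.union hN hx ha hs h₂⟩
  rcases lt_or_ge a.degree q with hq | hq
  · rcases u.eq_empty_or_nonempty with rfl | ⟨x, hx⟩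
    · exact ⟨_, isStandardPartition_singleton (fun b hb => mem_cell_empty.1 hb ▸ ha) (by simp)⟩
    · exact step x hx (((Finsupp.le_degree x a).trans_lt hq).trans_le hqD) fun h => by omega
  · obtain ⟨s, hsmem, hmax⟩ := (u.powerset.filter fun s => cell a s ⊆ N).exists_max_image
      Finset.card ⟨∅, Finset.mem_filter.2
        ⟨Finset.empty_mem_powerset u, fun b hb => mem_cell_empty.1 hb ▸ ha⟩⟩
    obtain ⟨hsu, hsN⟩ := Finset.mem_filter.1 hsmem
    rw [Finset.mem_powerset] at hsu
    have hmax' : ∀ s' ⊆ u, cell a s' ⊆ N → s'.card ≤ s.card := fun s' h h' =>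
      hmax s' (Finset.mem_filter.2 ⟨Finset.mem_powerset.2 h, h'⟩)
    rcases hsu.eq_or_ssubset with rfl | hss
    · exact ⟨_, isStandardPartition_singleton hsN fun _ => hq⟩
    · obtain ⟨x, hxu, hxs⟩ := Finset.exists_of_ssubset hss
      refine step x hxu ?_ fun _ =>
        ⟨s, fun i hi => Finset.mem_erase.2 ⟨fun e => hxs (e ▸ hi), hsu hi⟩, hsN, hmax'⟩
      -- If `D ≤ a x`, then `x` could be added to `s`.
      by_contra! hxD
      have hins : cell a (insert x s) ⊆ N := by
        intro b hb
        have h1 : b.update x (a x) ∈ cell a s := by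
          refine ⟨fun i => ?_, fun i hi => ?_⟩
          · by_cases hix : i = x
            · simp [hix]
            · simpa [hix] using hb.1 i
          · by_cases hix : i = x
            · simp [hix]
            · simpa [hix] using hb.2 i (by simp [hix, hi])
        have h2 := hD _ (hsN h1) x (by simpa using hxD) (b x - a x)
        convert h2 using 1
        ext i
        by_cases hix : i = x
        · have := hb.1 x
          subst hix
          simp only [Finsupp.add_apply, Finsupp.single_eq_same, Finsupp.update_apply, if_true]
          omega
        · simp [hix]
      have := hmax' _ (Finset.insert_subset hxu hsu) hins
      rw [Finset.card_insert_of_notMem hxs] at this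
      omega

end Cells

end FreeModGB

noncomputable section

/-! ### Submodules spanned by monomials -/

namespace FreeModGB

variable {𝕜 : Type*} [Field 𝕜] {n m : ℕ}

theorem ext_coeffAt {f g : FreeMod 𝕜 n m} (h : ∀ μ, coeffAt μ f = coeffAt μ g) : f = g :=
  funext fun j => MvPolynomial.ext _ _ fun a => h (a, j)

@[simp] theorem coeffAt_zero (μ : Mon n m) : coeffAt μ (0 : FreeMod 𝕜 n m) = 0 := by
  simp [coeffAt]

@[simp] theorem coeffAt_add (μ : Mon n m) (f g : FreeMod 𝕜 n m) :
    coeffAt μ (f + g) = coeffAt μ f + coeffAt μ g := by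
  simp [coeffAt]

@[simp] theorem coeffAt_sub (μ : Mon n m) (f g : FreeMod 𝕜 n m) :
    coeffAt μ (f - g) = coeffAt μ f - coeffAt μ g := by
  simp [coeffAt]

@[simp] theorem coeffAt_smul (μ : Mon n m) (c : 𝕜) (f : FreeMod 𝕜 n m) :
    coeffAt μ (c • f) = c * coeffAt μ f := by
  simp [coeffAt]

theorem coeffAt_toMod (μ ν : Mon n m) [Decidable (ν = μ)] :
    coeffAt μ (Mon.toMod 𝕜 ν) = if ν = μ then 1 else 0 := by
  classical
  obtain ⟨a, i⟩ := μ
  obtain ⟨b, j⟩ := ν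
  by_cases h : i = j
  · subst h
    simp [coeffAt, Mon.toMod, MvPolynomial.coeff_monomial]
  · simp [coeffAt, Mon.toMod, h, Ne.symm h]

theorem mem_monomials_toMod {μ ν : Mon n m} : μ ∈ monomials (Mon.toMod 𝕜 ν) ↔ μ = ν := by
  classical
  simp [monomials, coeffAt_toMod, eq_comm]

theorem toMod_ne_zero (μ : Mon n m) : Mon.toMod 𝕜 μ ≠ 0 := fun h => by
  have : μ ∈ monomials (Mon.toMod 𝕜 μ) := mem_monomials_toMod.2 rfl
  simp [h, monomials] at this

theorem toMod_add (c a : Fin n →₀ ℕ) (j : Fin m) :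
    Mon.toMod 𝕜 (c + a, j) = MvPolynomial.monomial c (1 : 𝕜) • Mon.toMod 𝕜 (a, j) := by
  simp [Mon.toMod, ← Pi.single_smul, MvPolynomial.monomial_mul]

theorem exists_of_mem_monomials_smul {p : Poly 𝕜 n} {f : FreeMod 𝕜 n m} {ν : Mon n m}
    (h : ν ∈ monomials (p • f)) :
    ∃ c b, c + b = ν.1 ∧ MvPolynomial.coeff c p ≠ 0 ∧ (b, ν.2) ∈ monomials f := by
  classical
  have h' : MvPolynomial.coeff ν.1 (p * f ν.2) ≠ 0 := h
  rw [MvPolynomial.coeff_mul] at h'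
  obtain ⟨⟨c, b⟩, hcb, hne⟩ := Finset.exists_ne_zero_of_sum_ne_zero h'
  exact ⟨c, b, Finset.HasAntidiagonal.mem_antidiagonal.1 hcb, left_ne_zero_of_mul hne, right_ne_zero_of_mul hne⟩

theorem finite_monomials (f : FreeMod 𝕜 n m) : (monomials f).Finite := by
  refine (Set.finite_iUnion fun j : Fin m =>
    ((f j).support.finite_toSet.image fun a => ((a, j) : Mon n m))).subset ?_
  rintro ⟨a, j⟩ h
  exact Set.mem_iUnion.2 ⟨j, a, MvPolynomial.mem_support_iff.2 h, rfl⟩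

/-- The `𝕜`-subspace of `F` of the elements whose monomials all lie in `A`. -/
def monomialSpan (𝕜 : Type*) [Field 𝕜] (A : Set (Mon n m)) : Submodule 𝕜 (FreeMod 𝕜 n m) where
  carrier := {f | monomials f ⊆ A}
  zero_mem' := by simp [monomials]
  add_mem' {f g} hf hg μ hμ := by
    by_contra h
    have h1 : coeffAt μ f = 0 := by_contra fun h' => h (hf h')
    have h2 : coeffAt μ g = 0 := by_contra fun h' => h (hg h')
    exact hμ (by simp [h1, h2])
  smul_mem' c f hf μ hμ := hf fun h => hμ (by simp [h])

theorem monomialSpan_mono {A B : Set (Mon n m)} (h : A ⊆ B) :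
    monomialSpan 𝕜 A ≤ monomialSpan 𝕜 B :=
  fun _ hf => Set.Subset.trans hf h

theorem monomialSpan_eq_span (A : Set (Mon n m)) :
    monomialSpan 𝕜 A = Submodule.span 𝕜 (Mon.toMod 𝕜 '' A) := by
  classical
  refine le_antisymm (fun f hf => ?_) (Submodule.span_le.2 ?_)
  · have hsum : f = ∑ μ ∈ (finite_monomials f).toFinset, coeffAt μ f • Mon.toMod 𝕜 μ := by
      refine ext_coeffAt fun ν => ?_
      have hlin : ∀ s : Finset (Mon n m), coeffAt ν (∑ μ ∈ s, coeffAt μ f • Mon.toMod 𝕜 μ) =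
          ∑ μ ∈ s, coeffAt μ f * coeffAt ν (Mon.toMod 𝕜 μ) := by
        intro s
        induction s using Finset.induction_on with
        | empty => simp
        | insert μ s hμ ih => rw [Finset.sum_insert hμ, Finset.sum_insert hμ, coeffAt_add, ih,
            coeffAt_smul]
      rw [hlin]
      simp only [coeffAt_toMod, mul_ite, mul_one, mul_zero, Finset.sum_ite_eq',
        Set.Finite.mem_toFinset]
      split_ifs with h
      · rfl
      · exact not_not.1 h
    rw [hsum]
    refine Submodule.sum_mem _ fun μ hμ => Submodule.smul_mem _ _ (Submodule.subset_span ?_)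
    exact ⟨μ, hf ((finite_monomials f).mem_toFinset.1 hμ), rfl⟩
  · rintro _ ⟨μ, hμ, rfl⟩ ν hν
    rwa [mem_monomials_toMod.1 hν]

theorem iSup_monomialSpan {ι : Type*} (A : ι → Set (Mon n m)) :
    ⨆ i, monomialSpan 𝕜 (A i) = monomialSpan 𝕜 (⋃ i, A i) := by
  simp only [monomialSpan_eq_span, Set.image_iUnion, Submodule.span_iUnion]

theorem iSupIndep_monomialSpan {ι : Type*} {A : ι → Set (Mon n m)}
    (h : ∀ i j, i ≠ j → Disjoint (A i) (A j)) : iSupIndep fun i => monomialSpan 𝕜 (A i) := by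
  intro i
  have hle : ⨆ j, ⨆ _ : j ≠ i, monomialSpan 𝕜 (A j) ≤ monomialSpan 𝕜 (A i)ᶜ :=
    iSup₂_le fun j hj => monomialSpan_mono (Set.disjoint_left.1 (h j i hj))
  refine Disjoint.mono_right hle (Submodule.disjoint_def.2 fun f hf hf' => ?_)
  refine ext_coeffAt fun μ => ?_
  by_contra hne
  have hμ : μ ∈ monomials f := fun h0 => hne (by simp [h0])
  exact hf' hμ (hf hμ)

/-! ### Cones with monomial pivots -/

/-- The set of monomials `x^b e_j` of `F` with `b` in `cell a u`. -/
def modCell (C : Fin m × (Fin n →₀ ℕ) × Finset (Fin n)) : Set (Mon n m) :=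
  {μ | μ.2 = C.1 ∧ μ.1 ∈ cell C.2.1 C.2.2}

/-- The cone `x^a e_j 𝕜[u]`. -/
def monCone (𝕜 : Type*) [Field 𝕜] (w : Fin m → ℕ) (C : Fin m × (Fin n →₀ ℕ) × Finset (Fin n)) :
    Cone 𝕜 n w where
  pivot := Mon.toMod 𝕜 (C.2.1, C.1)
  vars := C.2.2
  deg := C.2.1.degree + w C.1
  pivot_ne_zero := toMod_ne_zero _
  pivot_homogeneous μ hμ := by rw [mem_monomials_toMod.1 hμ]; rfl

theorem space_monCone (w : Fin m → ℕ) (C : Fin m × (Fin n →₀ ℕ) × Finset (Fin n)) :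
    (monCone 𝕜 w C).space = monomialSpan 𝕜 (modCell C) := by
  obtain ⟨j, a, u⟩ := C
  apply le_antisymm
  · rintro _ ⟨p, hp, rfl⟩ ν hν
    have hp' : (p.vars : Set (Fin n)) ⊆ u := MvPolynomial.mem_supported.1 hp
    obtain ⟨c, b, hcb, hc, hb⟩ := exists_of_mem_monomials_smul (f := Mon.toMod 𝕜 (a, j)) hν
    obtain ⟨rfl, h2⟩ := Prod.mk.inj (mem_monomials_toMod.1 hb)
    refine ⟨h2, hcb ▸ le_add_self, fun i hi => ?_⟩
    have hci : c i = 0 := by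
      by_contra h
      exact hi (hp' ((MvPolynomial.mem_vars_iff_mem_support i).2
        ⟨c, MvPolynomial.mem_support_iff.2 hc, Finsupp.mem_support_iff.2 h⟩))
    rw [← hcb, Finsupp.add_apply, hci, zero_add]
  · rw [monomialSpan_eq_span, Submodule.span_le]
    rintro _ ⟨⟨b, i⟩, ⟨hi, hab, hb⟩, rfl⟩
    obtain rfl : i = j := hi
    refine ⟨MvPolynomial.monomial (b - a) 1, ?_, ?_⟩
    · change _ ∈ MvPolynomial.supported 𝕜 _
      rw [MvPolynomial.mem_supported, MvPolynomial.vars_monomial one_ne_zero]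
      intro k hk
      by_contra hku
      have h1 := hb k hku
      have h2 := Finsupp.mem_support_iff.1 hk
      simp only [Finsupp.tsub_apply] at h2
      simp only at h1
      omega
    · change MvPolynomial.monomial (b - a) (1 : 𝕜) • Mon.toMod 𝕜 (a, i) = _
      rw [← toMod_add, tsub_add_cancel_of_le hab]

/-- The `l`-standard decomposition of the span of a set `N` of monomials closed under divisors:
the union over `j` of standard partitions of the `j`-th component of `N`. In the `j`-th component the
degrees are shifted by `w j`, so it has to be `(l - w j)`-standard. The hypothesis `hD` says that
the minimal monomials outside `N` have exponents at most `D`. -/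
theorem exists_standard_coneDecomposition (w : Fin m → ℕ) {l : ℕ} (hl : ∀ j, w j ≤ l)
    {N : Set (Mon n m)} (hN : ∀ μ ν, Mon.Dvd μ ν → ν ∈ N → μ ∈ N) {D : ℕ}
    (hD : ∀ a j, (a, j) ∈ N → ∀ x, D ≤ a x → ∀ k, (a + Finsupp.single x k, j) ∈ N) :
    ∃ Q : Finset (Cone 𝕜 n w), IsConeDecomposition Q (monomialSpan 𝕜 N : Set (FreeMod 𝕜 n m)) ∧
      IsStandard l Q ∧ ∀ μ, μ ∉ N → (∀ ν, ν ∉ N → Mon.Dvd ν μ → ν = μ) →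
        ((Mon.deg w μ : ℕ) : WithBot ℕ) ≤ max (1 + coneDeg Q) (l : WithBot ℕ) := by
  classical
  have key : ∀ j, ∃ P, IsStandardPartition {a | (a, j) ∈ N} (l - w j) 0 Finset.univ P := fun j =>
    exists_isStandardPartition (D := max D (l - w j))
      (fun a b hba ha => hN (b, j) (a, j) ⟨rfl, hba⟩ ha) (le_max_right _ _)
      (fun a ha x hx k => hD a j ha x ((le_max_left _ _).trans hx) k) 0 Finset.univ
  choose P hP using key
  have huniv : ∀ b : Fin n →₀ ℕ, b ∈ cell 0 Finset.univ := fun b =>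
    ⟨zero_le, fun i hi => (hi (Finset.mem_univ i)).elim⟩
  set T : Finset (Fin m × (Fin n →₀ ℕ) × Finset (Fin n)) :=
    Finset.univ.biUnion fun j => (P j).map ⟨Prod.mk j, Prod.mk_right_injective j⟩ with hT
  have memT : ∀ C, C ∈ T ↔ C.2 ∈ P C.1 := by
    rintro ⟨j, C⟩
    simp [hT]
  have hdisj : ∀ C ∈ T, ∀ C' ∈ T, C ≠ C' → Disjoint (modCell C) (modCell C') := by
    rintro ⟨j, C⟩ hC ⟨j', C'⟩ hC' hne
    rw [Set.disjoint_left]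
    rintro ⟨b, i⟩ ⟨h1, h2⟩ ⟨h3, h4⟩
    obtain rfl : i = j := h1
    obtain rfl : i = j' := h3
    exact Set.disjoint_left.1 ((hP i).disjoint C ((memT _).1 hC) C' ((memT _).1 hC')
      fun e => hne (by rw [e])) h2 h4
  have hle : ∀ j, ∀ C ∈ P j, ((C.1.degree + w j : ℕ) : WithBot ℕ) ≤
      coneDeg (T.image (monCone 𝕜 w)) := fun j C hC =>
    Finset.le_sup (f := fun C : Cone 𝕜 n w => (C.deg : WithBot ℕ))
      (Finset.mem_image_of_mem (monCone 𝕜 w) ((memT (j, C)).2 hC))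
  refine ⟨T.image (monCone 𝕜 w), ⟨?_, ?_⟩, ⟨?_, ?_⟩, ?_⟩
  · choose t ht hmk using fun C : T.image (monCone 𝕜 w) => Finset.mem_image.1 C.2
    have : (fun C : T.image (monCone 𝕜 w) => C.1.space) =
        fun C : T.image (monCone 𝕜 w) => monomialSpan 𝕜 (modCell (t C)) := by
      funext C
      rw [← space_monCone w, hmk C]
    rw [this]
    refine iSupIndep_monomialSpan fun C C' hne => hdisj _ (ht C) _ (ht C') fun e => hne ?_
    exact Subtype.ext (by rw [← hmk C, e, hmk C'])
  · have h1 : ⨆ C : T.image (monCone 𝕜 w), C.1.space = ⨆ C : T, monomialSpan 𝕜 (modCell C.1) := by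
      rw [iSup_subtype, iSup_subtype]
      simp only [Finset.mem_image, iSup_exists, iSup_and]
      simp only [← space_monCone w]
      rw [iSup_comm]
      refine iSup_congr fun C => ?_
      rw [iSup_comm]
      refine iSup_congr fun hC => ?_
      exact iSup_iSup_eq_right (b := monCone 𝕜 w C) (f := fun C _ => C.space)
    rw [h1, iSup_monomialSpan]
    congr 2
    ext ⟨b, i⟩
    have h2 := (hP i).mem_iff b
    simp only [huniv, and_true, Set.mem_ofPred_eq] at h2
    rw [← h2, Set.mem_iUnion]
    constructor
    · rintro ⟨⟨⟨j, C⟩, hC⟩, hj, hb⟩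
      obtain rfl : i = j := hj
      exact ⟨C, (memT _).1 hC, hb⟩
    · rintro ⟨C, hC, hb⟩
      exact ⟨⟨(i, C), (memT _).2 hC⟩, rfl, hb⟩
  · intro C hC hpos hlt
    obtain ⟨⟨j, C⟩, hCT, rfl⟩ := Finset.mem_image.1 hC
    have h1 := (hP j).le_degree C ((memT (j, C)).1 hCT) hpos
    change C.1.degree + w j < l at hlt
    omega
  · intro C hC hpos d hd hdC
    obtain ⟨⟨j, C⟩, hCT, rfl⟩ := Finset.mem_image.1 hC
    change d ≤ C.1.degree + w j at hdC
    have hj := hl j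
    obtain ⟨C', hC', h1, h2⟩ := (hP j).standard C ((memT (j, C)).1 hCT) hpos (d - w j) (by omega)
      (by simp) (by omega)
    refine ⟨monCone 𝕜 w (j, C'), Finset.mem_image_of_mem _ ((memT _).2 hC'), ?_, h2⟩
    change C'.1.degree + w j = d
    omega
  · rintro ⟨g, j⟩ hg hmin
    have hj := hl j
    rw [le_max_iff]
    rcases (hP j).bound g (huniv g) hg
      (fun g' _ hg' hle => congrArg Prod.fst (hmin (g', j) hg' ⟨rfl, hle⟩)) with h | h | ⟨C, hC, h⟩
    · right
      refine WithBot.coe_le_coe.2 ?_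
      change g.degree + w j ≤ l
      omega
    · right
      refine WithBot.coe_le_coe.2 ?_
      change g.degree + w j ≤ l
      simp only [map_zero] at h
      omega
    · left
      calc ((Mon.deg w (g, j) : ℕ) : WithBot ℕ) ≤ ((1 + (C.1.degree + w j) : ℕ) : WithBot ℕ) :=
            Nat.cast_le.2 (by change g.degree + w j ≤ _; omega)
        _ = 1 + ((C.1.degree + w j : ℕ) : WithBot ℕ) := by push_cast; rfl
        _ ≤ _ := add_le_add_right (hle j C hC) 1

end FreeModGB

end

/-! ### Initial monomials and Gröbner bases -/

namespace FreeModGB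

variable {𝕜 : Type*} [Field 𝕜] {n m : ℕ}

theorem Mon.Dvd.trans {μ ν ρ : Mon n m} (h : Mon.Dvd μ ν) (h' : Mon.Dvd ν ρ) : Mon.Dvd μ ρ :=
  ⟨h.1.trans h'.1, h.2.trans h'.2⟩

theorem MonOrder.eq_or_lt_of_dvd (o : MonOrder n m) {μ ν : Mon n m} (h : Mon.Dvd μ ν) :
    μ = ν ∨ o.lt μ ν := by
  obtain ⟨a, i⟩ := μ
  obtain ⟨b, j⟩ := ν
  obtain ⟨h1, h2⟩ := h
  obtain rfl : i = j := h1
  rcases eq_or_ne (b - a) 0 with hc | hc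
  · exact Or.inl (Prod.ext (le_antisymm h2 (tsub_eq_zero_iff_le.1 hc)) rfl)
  · have := o.lt_mul (b - a) a i hc
    rw [tsub_add_cancel_of_le h2] at this
    exact Or.inr this

theorem exists_isInitial (o : MonOrder n m) {f : FreeMod 𝕜 n m} (hf : f ≠ 0) :
    ∃ μ, IsInitial o f μ := by
  have hne : (monomials f).Nonempty := by
    by_contra h
    rw [Set.not_nonempty_iff_eq_empty] at h
    refine hf (ext_coeffAt fun μ => ?_)
    by_contra hμ
    exact Set.notMem_empty μ (h ▸ (fun h0 => hμ (by simp [h0]) : μ ∈ monomials f))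
  have key : ∀ s : Set (Mon n m), s.Finite → s.Nonempty → ∃ μ ∈ s, ∀ ν ∈ s, ν = μ ∨ o.lt ν μ := by
    intro s hs
    induction s, hs using Set.Finite.induction_on with
    | empty => simp
    | @insert μ s _ _ ih =>
      intro _
      rcases s.eq_empty_or_nonempty with rfl | hs
      · exact ⟨μ, by simp, by simp⟩
      obtain ⟨ρ, hρ, hmax⟩ := ih hs
      rcases o.total μ ρ with h | rfl | h
      · refine ⟨ρ, Or.inr hρ, ?_⟩
        rintro ν (rfl | hν)
        exacts [Or.inr h, hmax ν hν]
      · refine ⟨μ, Or.inl rfl, ?_⟩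
        rintro ν (rfl | hν)
        exacts [Or.inl rfl, hmax ν hν]
      · refine ⟨μ, Or.inl rfl, ?_⟩
        rintro ν (rfl | hν)
        · exact Or.inl rfl
        · rcases hmax ν hν with rfl | h'
          exacts [Or.inr h, Or.inr (o.trans _ _ _ h' h)]
  exact key _ (finite_monomials f) hne

theorem IsInitial.eq {o : MonOrder n m} {f : FreeMod 𝕜 n m} {μ ν : Mon n m}
    (hμ : IsInitial o f μ) (hν : IsInitial o f ν) : μ = ν := by
  rcases hν.2 μ hμ.1 with h | h
  · exact h
  · rcases hμ.2 ν hν.1 with h' | h'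
    · exact h'.symm
    · exact (o.irrefl _ (o.trans _ _ _ h h')).elim

/-- The multiples of the initial monomials of the elements of `A`. -/
def initialMonomials (o : MonOrder n m) (A : Set (FreeMod 𝕜 n m)) : Set (Mon n m) :=
  {ν | ∃ f ∈ A, ∃ μ, IsInitial o f μ ∧ Mon.Dvd μ ν}

theorem toMod_mem_initialSpan {o : MonOrder n m} {A : Set (FreeMod 𝕜 n m)} {μ : Mon n m} :
    Mon.toMod 𝕜 μ ∈ initialSpan o A ↔ μ ∈ initialMonomials o A := by
  constructor
  · have key : ∀ f ∈ initialSpan o A, f ∈ monomialSpan 𝕜 (initialMonomials o A) := by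
      intro f hf
      induction hf using Submodule.span_induction with
      | mem e he =>
        obtain ⟨f, hf, μ, hμ, rfl⟩ := he
        intro ν hν
        rw [mem_monomials_toMod.1 hν]
        exact ⟨f, hf, μ, hμ, rfl, le_rfl⟩
      | zero => exact Submodule.zero_mem _
      | add f g _ _ hf hg => exact Submodule.add_mem _ hf hg
      | smul p f _ hf =>
        intro ν hν
        obtain ⟨c, b, hcb, -, hb⟩ := exists_of_mem_monomials_smul hν
        obtain ⟨g, hg, μ, hμ, hdvd⟩ := hf hb
        exact ⟨g, hg, μ, hμ, hdvd.trans ⟨rfl, hcb ▸ le_add_self⟩⟩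
    exact fun h => key _ h (mem_monomials_toMod.2 rfl)
  · rintro ⟨f, hf, ⟨a, i⟩, hμ, h1, h2⟩
    obtain ⟨b, j⟩ := μ
    obtain rfl : i = j := h1
    have : b = (b - a) + a := (tsub_add_cancel_of_le h2).symm
    rw [this, toMod_add]
    exact Submodule.smul_mem _ _ (Submodule.subset_span ⟨f, hf, _, hμ, rfl⟩)

theorem IsGroebnerBasis.initialMonomials_eq {o : MonOrder n m}
    {M : Submodule (Poly 𝕜 n) (FreeMod 𝕜 n m)} {G : Set (FreeMod 𝕜 n m)}
    (hG : IsGroebnerBasis o M G) :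
    initialMonomials o G = initialMonomials o (M : Set (FreeMod 𝕜 n m)) := by
  ext μ
  rw [← toMod_mem_initialSpan, hG.2.2, toMod_mem_initialSpan]

theorem normalForms_eq (o : MonOrder n m) (G : Set (FreeMod 𝕜 n m)) :
    normalForms o G = (monomialSpan 𝕜 (initialMonomials o G)ᶜ : Set (FreeMod 𝕜 n m)) := by
  ext r
  constructor
  · rintro ⟨f, a, -, -, -, h⟩ ν hν ⟨g, hg, μ, hμ, hdvd⟩
    exact h g hg μ hμ ν hν hdvd
  · intro hr
    refine ⟨r, 0, by simp, by simp, fun g _ μ hμ => ?_, fun g hg μ hμ ν hν hdvd =>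
      hr hν ⟨g, hg, μ, hμ, hdvd⟩⟩
    simpa [IsInitial, monomials] using hμ.1

/-- A minimal generator of the initial module: a multiple of an initial monomial of `A` which is not a
proper multiple of any other one. -/
def IsMinimalInitial (o : MonOrder n m) (A : Set (FreeMod 𝕜 n m)) (μ : Mon n m) : Prop :=
  μ ∈ initialMonomials o A ∧ ∀ ν ∈ initialMonomials o A, Mon.Dvd ν μ → ν = μ

theorem exists_isMinimalInitial {o : MonOrder n m} {A : Set (FreeMod 𝕜 n m)} {μ : Mon n m}
    (h : μ ∈ initialMonomials o A) : ∃ ν, IsMinimalInitial o A ν ∧ Mon.Dvd ν μ := by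
  obtain ⟨b, j⟩ := μ
  obtain ⟨a, hab, ha, hmin⟩ := exists_minimal_le_of_wellFoundedLT
    (fun a => (a, j) ∈ initialMonomials o A) b h
  refine ⟨(a, j), ⟨ha, ?_⟩, rfl, hab⟩
  rintro ⟨c, i⟩ hc ⟨h1, h2⟩
  obtain rfl : i = j := h1
  exact Prod.ext (le_antisymm h2 (hmin hc h2)) rfl

theorem IsMinimalInitial.exists_isInitial {o : MonOrder n m} {A : Set (FreeMod 𝕜 n m)}
    {μ : Mon n m} (h : IsMinimalInitial o A μ) : ∃ f ∈ A, IsInitial o f μ := by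
  obtain ⟨⟨f, hf, ν, hν, hdvd⟩, hmin⟩ := h
  obtain rfl := hmin ν ⟨f, hf, ν, hν, rfl, le_rfl⟩ hdvd
  exact ⟨f, hf, hν⟩

theorem exists_exponent_bound (o : MonOrder n m) {G : Set (FreeMod 𝕜 n m)} (hG : G.Finite) :
    ∃ D, ∀ g ∈ G, ∀ μ, IsInitial o g μ → ∀ x, μ.1 x ≤ D := by
  obtain ⟨D, hD⟩ := ((hG.biUnion fun g _ => finite_monomials g).image
    fun μ : Mon n m => μ.1.degree).bddAbove
  exact ⟨D, fun g hg μ hμ x => (Finsupp.le_degree x μ.1).trans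
    (hD ⟨μ, Set.mem_biUnion hg hμ.1, rfl⟩)⟩

theorem deg_le_iff {w : Fin m → ℕ} {f : FreeMod 𝕜 n m} {B : WithBot ℕ} :
    deg w f ≤ B ↔ ∀ μ ∈ monomials f, ((Mon.deg w μ : ℕ) : WithBot ℕ) ≤ B := by
  simp only [deg, Finset.sup_le_iff, Finset.mem_univ, true_implies, MvPolynomial.mem_support_iff]
  exact ⟨fun h μ hμ => h μ.2 μ.1 hμ, fun h j a ha => h (a, j) ha⟩

theorem IsHomogeneous.deg_le {w : Fin m → ℕ} {f : FreeMod 𝕜 n m} (hf : IsHomogeneous w f)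
    {μ : Mon n m} (hμ : μ ∈ monomials f) {B : WithBot ℕ}
    (h : ((Mon.deg w μ : ℕ) : WithBot ℕ) ≤ B) : deg w f ≤ B := by
  obtain ⟨d, hd⟩ := hf
  refine deg_le_iff.2 fun ν hν => ?_
  rwa [hd ν hν, ← hd μ hμ]

theorem coeffAt_homComponent (w : Fin m → ℕ) (d : ℕ) (f : FreeMod 𝕜 n m) (μ : Mon n m) :
    coeffAt μ (homComponent w d f) = if Mon.deg w μ = d then coeffAt μ f else 0 := by
  obtain ⟨a, j⟩ := μ
  have hdeg : Mon.deg w (a, j) = a.degree + w j := rfl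
  simp only [coeffAt, homComponent]
  by_cases h : w j ≤ d
  · rw [if_pos h, MvPolynomial.coeff_homogeneousComponent]
    exact if_congr (by omega) rfl rfl
  · have hne : Mon.deg w (a, j) ≠ d := by omega
    rw [if_neg h, if_neg hne, MvPolynomial.coeff_zero]

theorem IsReducedGroebnerBasis.eq_of_dvd {o : MonOrder n m}
    {M : Submodule (Poly 𝕜 n) (FreeMod 𝕜 n m)} {R : Set (FreeMod 𝕜 n m)}
    (hR : IsReducedGroebnerBasis o M R) {g : FreeMod 𝕜 n m} (hg : g ∈ R) {μ ν : Mon n m}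
    (hμ : IsInitial o g μ) (hν : ν ∈ monomials g) (hνR : ν ∈ initialMonomials o R) : ν = μ := by
  obtain ⟨g', hg', μ', hμ', hdvd⟩ := hνR
  obtain rfl : g' = g := by_contra fun h => hR.2.2 g hg g' hg' h μ' hμ' ν hν hdvd
  obtain rfl := hμ.eq hμ'
  rcases o.eq_or_lt_of_dvd hdvd with h | h
  · exact h.symm
  · rcases hμ.2 ν hν with h' | h'
    · exact h'
    · exact (o.irrefl _ (o.trans _ _ _ h h')).elim

/-- A reduced Gröbner basis of a graded submodule is homogeneous: if `d` is the degree of the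
initial monomial of `g`, then `g` minus its component of degree `d` lies in `M`, but none of its
monomials is an initial monomial of `M`. -/
theorem IsReducedGroebnerBasis.isHomogeneous {o : MonOrder n m} {w : Fin m → ℕ}
    {M : Submodule (Poly 𝕜 n) (FreeMod 𝕜 n m)} (hM : IsGraded w M) {R : Set (FreeMod 𝕜 n m)}
    (hR : IsReducedGroebnerBasis o M R) {g : FreeMod 𝕜 n m} (hg : g ∈ R) :
    IsHomogeneous w g := by
  obtain ⟨μ, hμ, -⟩ := hR.2.1 g hg
  have hgM : g ∈ M := hR.1.2.1 hg
  have hsub : g - homComponent w (Mon.deg w μ) g = 0 := by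
    by_contra hne
    obtain ⟨ν, hν⟩ := exists_isInitial o hne
    have hν1 : coeffAt ν (g - homComponent w (Mon.deg w μ) g) ≠ 0 := hν.1
    rw [coeffAt_sub, coeffAt_homComponent] at hν1
    have hdeg : Mon.deg w ν ≠ Mon.deg w μ := fun h => by simp [h] at hν1
    rw [if_neg hdeg, sub_zero] at hν1
    refine hdeg (congrArg _ (hR.eq_of_dvd hg hμ hν1 ?_))
    rw [hR.1.initialMonomials_eq]
    exact ⟨_, M.sub_mem hgM (hM g hgM _), ν, hν, rfl, le_rfl⟩
  refine ⟨Mon.deg w μ, fun ν hν => ?_⟩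
  by_contra hdeg
  have h := congrArg (coeffAt ν) (sub_eq_zero.1 hsub)
  rw [coeffAt_homComponent, if_neg hdeg] at h
  exact hν h

theorem IsReducedGroebnerBasis.isMinimalInitial {o : MonOrder n m}
    {M : Submodule (Poly 𝕜 n) (FreeMod 𝕜 n m)} {R : Set (FreeMod 𝕜 n m)}
    (hR : IsReducedGroebnerBasis o M R) {g : FreeMod 𝕜 n m} (hg : g ∈ R) {μ : Mon n m}
    (hμ : IsInitial o g μ) : IsMinimalInitial o R μ := by
  obtain ⟨ν, hν, hdvd⟩ := exists_isMinimalInitial (o := o) (A := R) ⟨g, hg, μ, hμ, rfl, le_rfl⟩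
  obtain ⟨g', hg', hν'⟩ := hν.exists_isInitial
  obtain rfl : g' = g := by_contra fun h => hR.2.2 g hg g' hg' h ν hν' μ hμ.1 hdvd
  exact hμ.eq hν' ▸ hν

/-- A subset of a Gröbner basis is again one as soon as it contains every element whose initial
monomial is a minimal generator of the initial module. -/
theorem IsGroebnerBasis.of_subset {o : MonOrder n m} {M : Submodule (Poly 𝕜 n) (FreeMod 𝕜 n m)}
    {G G' : Set (FreeMod 𝕜 n m)} (hG : IsGroebnerBasis o M G) (hsub : G' ⊆ G)
    (h : ∀ g ∈ G, ∀ μ, IsInitial o g μ → IsMinimalInitial o G μ → g ∈ G') :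
    IsGroebnerBasis o M G' := by
  refine ⟨hG.1.subset hsub, hsub.trans hG.2.1, ?_⟩
  rw [← hG.2.2]
  refine le_antisymm (Submodule.span_mono ?_) (Submodule.span_le.2 ?_)
  · rintro _ ⟨f, hf, μ, hμ, rfl⟩
    exact ⟨f, hsub hf, μ, hμ, rfl⟩
  · rintro _ ⟨f, hf, μ, hμ, rfl⟩
    refine toMod_mem_initialSpan.2 ?_
    obtain ⟨ν, hν, hdvd⟩ := exists_isMinimalInitial (o := o) (A := G) ⟨f, hf, μ, hμ, rfl, le_rfl⟩
    obtain ⟨g, hg, hgν⟩ := hν.exists_isInitial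
    exact ⟨g, h g hg ν hgν hν, ν, hgν, hdvd⟩

end FreeModGB

theorem theorem4p7 {𝕜 : Type*} [Field 𝕜] (n m : ℕ) (w : Fin m → ℕ)
    (o : FreeModGB.MonOrder n m)
    (M : Submodule (FreeModGB.Poly 𝕜 n) (FreeModGB.FreeMod 𝕜 n m))
    (hM : FreeModGB.IsGraded w M)
    (G : Set (FreeModGB.FreeMod 𝕜 n m))
    (hG : FreeModGB.IsGroebnerBasis o M G)
    (hGhom : ∀ g ∈ G, FreeModGB.IsHomogeneous w g)
    (l : ℕ) (hl : l = Finset.univ.sup w) :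
    ∃ Q : Finset (FreeModGB.Cone 𝕜 n w),
      FreeModGB.IsConeDecomposition Q (FreeModGB.normalForms o G) ∧
      FreeModGB.IsStandard l Q ∧
      FreeModGB.IsGroebnerBasis o M
        {g | g ∈ G ∧ FreeModGB.deg w g ≤ max (1 + FreeModGB.coneDeg Q) (l : WithBot ℕ)} ∧
      ∀ R : Set (FreeModGB.FreeMod 𝕜 n m), FreeModGB.IsReducedGroebnerBasis o M R →
        ∀ g ∈ R, FreeModGB.deg w g ≤ max (1 + FreeModGB.coneDeg Q) (l : WithBot ℕ) := by

  obtain ⟨D, hD⟩ := FreeModGB.exists_exponent_bound o hG.1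
  obtain ⟨Q, hQ, hstd, hbound⟩ := FreeModGB.exists_standard_coneDecomposition (𝕜 := 𝕜) w
    (fun j => hl ▸ Finset.le_sup (Finset.mem_univ j)) (N := (FreeModGB.initialMonomials o G)ᶜ)
    (fun μ ν hdvd hν ⟨g, hg, ρ, hρ, h⟩ => hν ⟨g, hg, ρ, hρ, h.trans hdvd⟩) (D := D) (by
      rintro a j ha x hx k ⟨g, hg, ρ, hρ, h1, h2⟩
      -- As `ρ x ≤ D ≤ a x`, if `ρ` divides `a + k x`, it divides `a` already.
      refine ha ⟨g, hg, ρ, hρ, h1, fun i => ?_⟩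
      by_cases hix : i = x
      · exact hix ▸ (hD g hg ρ hρ x).trans hx
      · simpa [hix] using h2 i)
  have hmin : ∀ μ, FreeModGB.IsMinimalInitial o G μ →
      ((FreeModGB.Mon.deg w μ : ℕ) : WithBot ℕ) ≤
        max (1 + FreeModGB.coneDeg Q) (l : WithBot ℕ) := fun μ hμ =>
    hbound μ (not_not_intro hμ.1) fun ν hν => hμ.2 ν (not_not.1 hν)
  refine ⟨Q, FreeModGB.normalForms_eq o G ▸ hQ, hstd, ?_, fun R hR g hg => ?_⟩
  · exact hG.of_subset (fun g hg => hg.1) fun g hg μ hμ hμG =>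
      ⟨hg, (hGhom g hg).deg_le hμ.1 (hmin μ hμG)⟩
  · obtain ⟨μ, hμ, -⟩ := hR.2.1 g hg
    have hμR := hR.isMinimalInitial hg hμ
    rw [FreeModGB.IsMinimalInitial, hR.1.initialMonomials_eq, ← hG.initialMonomials_eq] at hμR
    exact (hR.isHomogeneous hM hg).deg_le hμ.1 (hmin μ hμR)
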